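/- For $T\subset\mathbb R$ let $\mathcal P(T)$ be the set of Borel probability measures on $T$ all of whose moments exist, let $m_k(\mu)=\int_T x^k\,d\mu$, and let $\mathcal M_n(T)=\{(m_1(\mu),\dots,m_n(\mu)) : \mu\in\mathcal P(T)\}\subset\mathbb R^n$. Given $T$ and $\vec m_n=(m_1,\dots,m_n)$, let $m_k^-$ and (for bounded $T$) $m_k^+$ denote the minimum and the maximum of $m_k(\mu)$ over all $\mu\in\mathcal P(T)$ with $m_i(\mu)=m_i$ for $i=1,\dots,k-1$. For $d>0$ and real sequences $\gamma=(\gamma_k)_{k\ge1}$, $\delta=(\delta_k)_{k\ge1}$ with $\gamma_k,\delta_k>-1$ define, with $m_k^\pm$ taken with respect to $T=[0,d]$, $$f_n^{(\gamma,\delta)}(\vec m_n)=c_n^{[0,d]}\prod_{k=1}^n\Bigl(\frac{m_k-m_k^-}{m_k^+-m_k^-}\Bigr)^{\gamma_k}\Bigl(\frac{m_k^+-m_k}{m_k^+-m_k^-}\Bigr)^{\delta_k}\mathbb 1_{\{m_k^-<m_k<m_k^+\}},$$ $$c_n^{[0,d]}=\Bigl\{d^{\,n(n+1)/2}\prod_{k=1}^n\int_0^1x^{n-k+\gamma_k}(1-x)^{n-k+\delta_k}\,dx\Bigr\}^{-1},$$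 where $f_n^{(\gamma,\delta)}$ is understood to be $0$ outside $\mathcal M_n([0,d])$. **Theorem.** Let $n\in\mathbb N$ and, for real $d>0$, let $\gamma^{(d)}=(\gamma^{(d)}_k)_{k\ge1}$ and $\delta^{(d)}=(\delta^{(d)}_k)_{k\ge1}$ be real sequences such that, for every $k\ge1$, as $d\to\infty$, $$\gamma_k^{(d)}\to\gamma_k>-1,\qquad \frac{\delta_k^{(d)}}{d}\to\delta_k>0$$ (so that, for each $k$, $\gamma^{(d)}_k,\delta^{(d)}_k>-1$ for all large $d$). Then for every $\vec m_n\in\mathcal M_n([0,\infty))$ the values at $\vec m_n$ of the densities $f_n^{(\gamma^{(d)},\delta^{(d)})}$ on $\mathcal M_n([0,d])$ converge, as $d\to\infty$, to $$g_n^{(\gamma,\delta)}(\vec m_n)=c_n^{[0,\infty)}\prod_{k=1}^n\Bigl(\frac{m_k-m_k^-}{m_{k-1}-m_{k-1}^-}\Bigr)^{\gamma_k}\exp\Bigl(-\delta_k\frac{m_k-m_k^-}{m_{k-1}-m_{k-1}^-}\Bigr)\mathbb 1_{\{m_k>m_k^-\}} =c_n^{[0,\infty)}\prod_{k=1}^n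 z_k^{\gamma_k}e^{-\delta_kz_k}\mathbb 1_{\{z_k>0\}},$$ where now $m_k^-$ is taken with respect to $T=[0,\infty)$, $m_0=1$, $m_0^-=0$, $z_k=z_k(\vec m_n)=\frac{m_k-m_k^-}{m_{k-1}-m_{k-1}^-}$, and $$c_n^{[0,\infty)}=\prod_{k=1}^n\frac{\delta_k^{\gamma_k+n-k+1}}{\Gamma(\gamma_k+n-k+1)}.$$ Moreover, $g_n^{(\gamma,\delta)}$ (extended by $0$ outside $\mathcal M_n([0,\infty))$) is a probability density on $\mathcal M_n([0,\infty))$ with respect to Lebesgue measure on $\mathbb R^n$. -/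

import Mathlib

open MeasureTheory Set Filter Topology

noncomputable section

namespace MomentSpace

/-- `𝒫(T)`: the probability measures on `T` (as Borel measures on `ℝ` carried by `T`)
all of whose moments exist. -/
def probMeasures (T : Set ℝ) : Set (Measure ℝ) :=
  {μ | IsProbabilityMeasure μ ∧ μ Tᶜ = 0 ∧ ∀ k : ℕ, Integrable (fun x : ℝ => x ^ k) μ}

/-- The `k`-th moment of `μ`. -/
def moment (μ : Measure ℝ) (k : ℕ) : ℝ := ∫ x, x ^ k ∂μ

/-- The `n`-th moment space `ℳ_n(T)`. The coordinate with index `i : Fin n` of a moment vector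
is the moment of order `i + 1`. -/
def momentSpace (T : Set ℝ) (n : ℕ) : Set (Fin n → ℝ) :=
  {m | ∃ μ ∈ probMeasures T, ∀ i : Fin n, m i = moment μ (i + 1)}

/-- The values of the moment of order `i + 1` over all `μ ∈ 𝒫(T)` whose moments of
orders `1, …, i` are those prescribed by `m`. -/
def momentRange (T : Set ℝ) {n : ℕ} (m : Fin n → ℝ) (i : Fin n) : Set ℝ :=
  {y | ∃ μ ∈ probMeasures T, (∀ j : Fin n, j < i → moment μ (j + 1) = m j) ∧
    y = moment μ (i + 1)}

/-- The lower bound `m_k^-`, for `k = i + 1`. -/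
def lowerMoment (T : Set ℝ) {n : ℕ} (m : Fin n → ℝ) (i : Fin n) : ℝ :=
  sInf (momentRange T m i)

/-- The upper bound `m_k^+`, for `k = i + 1` (used for bounded `T`). -/
def upperMoment (T : Set ℝ) {n : ℕ} (m : Fin n → ℝ) (i : Fin n) : ℝ :=
  sSup (momentRange T m i)

/-- The normalizing constant `c_n^{[a,b]}` of the Beta-type density. -/
def betaConst (a b : ℝ) (γ δ : ℕ → ℝ) (n : ℕ) : ℝ :=
  ((b - a) ^ (n * (n + 1) / 2) *
    ∏ k ∈ Finset.Icc 1 n,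
      ∫ x in (0 : ℝ)..1, x ^ ((n : ℝ) - k + γ k) * (1 - x) ^ ((n : ℝ) - k + δ k))⁻¹

/-- The Beta-type density `f_n^{(γ,δ)}` on `ℳ_n([a,b])`, extended by `0`.
The parameters are `γ k`, `δ k` with `k ≥ 1`. -/
def betaDensity (a b : ℝ) (γ δ : ℕ → ℝ) (n : ℕ) (m : Fin n → ℝ) : ℝ :=
  betaConst a b γ δ n * ∏ i : Fin n,
    (((m i - lowerMoment (Icc a b) m i) /
        (upperMoment (Icc a b) m i - lowerMoment (Icc a b) m i)) ^ γ (i + 1) *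
      ((upperMoment (Icc a b) m i - m i) /
        (upperMoment (Icc a b) m i - lowerMoment (Icc a b) m i)) ^ δ (i + 1) *
      (if lowerMoment (Icc a b) m i < m i ∧ m i < upperMoment (Icc a b) m i then 1 else 0))

/-- `m_{k-1} - m_{k-1}^-` on `[0,∞)`, for `k = i + 1`, where `m_0 = 1` and `m_0^- = 0`. -/
def prevGap {n : ℕ} (m : Fin n → ℝ) (i : Fin n) : ℝ :=
  if (i : ℕ) = 0 then 1
  else m ⟨i - 1, by omega⟩ - lowerMoment (Ici 0) m ⟨i - 1, by omega⟩

/-- The recursion variable `z_k = (m_k - m_k^-) / (m_{k-1} - m_{k-1}^-)` on `[0,∞)`,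
for `k = i + 1`. -/
def recVar {n : ℕ} (m : Fin n → ℝ) (i : Fin n) : ℝ :=
  (m i - lowerMoment (Ici 0) m i) / prevGap m i

/-- The constant `c_n^{[0,∞)}`. -/
def gammaConst (γ δ : ℕ → ℝ) (n : ℕ) : ℝ :=
  ∏ k ∈ Finset.Icc 1 n,
    δ k ^ (γ k + n - k + 1) / Real.Gamma (γ k + n - k + 1)

/-- The function `g_n^{(γ,δ)}`, in terms of the moments and their lower bounds. -/
def gammaDensity (γ δ : ℕ → ℝ) (n : ℕ) (m : Fin n → ℝ) : ℝ :=
  gammaConst γ δ n * ∏ i : Fin n,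
    (((m i - lowerMoment (Ici 0) m i) / prevGap m i) ^ γ (i + 1) *
      Real.exp (-δ (i + 1) * ((m i - lowerMoment (Ici 0) m i) / prevGap m i)) *
      (if lowerMoment (Ici 0) m i < m i then 1 else 0))

/-- `g` is a probability density on `S ⊆ ℝⁿ` with respect to Lebesgue measure. -/
def IsDensityOn {n : ℕ} (g : (Fin n → ℝ) → ℝ) (S : Set (Fin n → ℝ)) : Prop :=
  Measurable g ∧ (∀ m, 0 ≤ g m) ∧ ∫⁻ m in S, ENNReal.ofReal (g m) = 1

end MomentSpace

end

namespace MomentSpace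

/-! ### Operations on probability measures with moments -/

/-! Both densities vanish unless every coordinate exceeds its lower bound on `[0,∞)`, so the
argument takes place on the set `regularMoments`. It is open and lies in the moment space of
`[0,∞)`; each of its points is already represented by a measure with bounded support, since the
moment spaces of the intervals `[0,d]` have a convex union that is dense in that of `[0,∞)`.

At a regular point two limits decide everything. The lower bound of `m_k` on `[0,d]` tends to the
one on `[0,∞)` (`tendsto_infNext_Icc`), and the upper bound divided by `d` tends to `m_{k-1} -
m_{k-1}^-` (`tendsto_supNext_Icc_div`). Hence the canonical coordinate `p_k = (m_k - m_k^-)/(m_k^+ -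
m_k^-)` satisfies `d p_k → z_k`, and `(1 - p_k)^{δ_k^{(d)}} → exp(-δ_k z_k)`. The powers of `d`
carried by `p_k^{γ_k^{(d)}}` and by the normalizing constant are exactly those that turn the Beta
integral into a Gamma integral (`tendsto_rpow_mul_integral_beta`).

For the total mass, the last coordinate is integrated first. Passing from `m_n` to `z_n` has
Jacobian `m_{n-1} - m_{n-1}^- = z_1 ⋯ z_{n-1}`, which raises each remaining `γ_k` by one. Induction
on `n` with `γ` arbitrary then produces the shifts `n - k` in the constant. -/

theorem ae_mem_of_mem_probMeasures {T : Set ℝ} {μ : Measure ℝ} (hμ : μ ∈ probMeasures T) :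
    ∀ᵐ x ∂μ, x ∈ T :=
  mem_ae_iff.2 hμ.2.1

theorem probMeasures_mono {S T : Set ℝ} (h : S ⊆ T) : probMeasures S ⊆ probMeasures T :=
  fun _ hμ => ⟨hμ.1, measure_mono_null (compl_subset_compl.2 h) hμ.2.1, hμ.2.2⟩

theorem moment_zero_of_mem {T : Set ℝ} {μ : Measure ℝ} (hμ : μ ∈ probMeasures T) :
    moment μ 0 = 1 := by
  have := hμ.1
  simp [moment]

theorem moment_nonneg {T : Set ℝ} (hT : T ⊆ Ici 0) {μ : Measure ℝ} (hμ : μ ∈ probMeasures T)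
    (k : ℕ) : 0 ≤ moment μ k := by
  apply integral_nonneg_of_ae
  filter_upwards [ae_mem_of_mem_probMeasures hμ] with x hx
  exact pow_nonneg (hT hx) k

theorem moment_le_pow {d : ℝ} {μ : Measure ℝ} (hμ : μ ∈ probMeasures (Icc 0 d)) (k : ℕ) :
    moment μ k ≤ d ^ k := by
  have := hμ.1
  calc moment μ k ≤ ∫ _, d ^ k ∂μ := by
        apply integral_mono_ae (hμ.2.2 k) (integrable_const _)
        filter_upwards [ae_mem_of_mem_probMeasures hμ] with x hx
        exact pow_le_pow_left₀ hx.1 hx.2 k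
    _ = d ^ k := by simp

theorem dirac_mem_probMeasures {T : Set ℝ} {x : ℝ} (hx : x ∈ T) :
    Measure.dirac x ∈ probMeasures T := by
  refine ⟨inferInstance, ?_, fun k => ?_⟩
  · simp [Measure.dirac_apply, hx]
  · exact integrable_dirac (by simp)

theorem moment_dirac (x : ℝ) (k : ℕ) : moment (Measure.dirac x) k = x ^ k := by
  simp [moment]

theorem exists_mixture {T : Set ℝ} {μ ν : Measure ℝ} (hμ : μ ∈ probMeasures T)
    (hν : ν ∈ probMeasures T) {a b : ℝ} (ha : 0 ≤ a) (hb : 0 ≤ b) (hab : a + b = 1) :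
    ∃ ρ ∈ probMeasures T, ∀ k, moment ρ k = a * moment μ k + b * moment ν k := by
  have := hμ.1
  have := hν.1
  have hi : ∀ k : ℕ, Integrable (fun x : ℝ => x ^ k) (ENNReal.ofReal a • μ) := fun k =>
    (hμ.2.2 k).smul_measure ENNReal.ofReal_ne_top
  have hi' : ∀ k : ℕ, Integrable (fun x : ℝ => x ^ k) (ENNReal.ofReal b • ν) := fun k =>
    (hν.2.2 k).smul_measure ENNReal.ofReal_ne_top
  refine ⟨ENNReal.ofReal a • μ + ENNReal.ofReal b • ν, ⟨⟨?_⟩, ?_, fun k => ?_⟩, fun k => ?_⟩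
  · simp [← ENNReal.ofReal_add ha hb, hab]
  · simp [hμ.2.1, hν.2.1]
  · exact (hi k).add_measure (hi' k)
  · rw [moment, integral_add_measure (hi k) (hi' k), integral_smul_measure,
      integral_smul_measure]
    simp [ha, hb, moment]

/-- Serves two changes of measure: truncation to `[0,d]`, and the weight `1 - x/d`, each normalized.
-/
theorem exists_tilted {S : Set ℝ} (hS : MeasurableSet S) {μ : Measure ℝ} {f : ℝ → ℝ}
    (hf : Measurable f) (hf0 : ∀ᵐ x ∂μ, 0 ≤ f x) (hfS : ∀ᵐ x ∂μ, x ∉ S → f x = 0)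
    (hfi : ∀ k : ℕ, Integrable (fun x => f x * x ^ k) μ) (h1 : ∫ x, f x ∂μ = 1) :
    ∃ ν ∈ probMeasures S, ∀ k, moment ν k = ∫ x, f x * x ^ k ∂μ := by
  have hm : Measurable fun x => ENNReal.ofReal (f x) := hf.ennreal_ofReal
  have htop : ∀ᵐ x ∂μ, ENNReal.ofReal (f x) < ⊤ := by simp
  have hcongr : ∀ k : ℕ, (fun x : ℝ => (ENNReal.ofReal (f x)).toReal • x ^ k) =ᵐ[μ]
      fun x => f x * x ^ k := fun k => by
    filter_upwards [hf0] with x hx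
    simp [ENNReal.toReal_ofReal hx]
  refine ⟨μ.withDensity fun x => ENNReal.ofReal (f x), ⟨⟨?_⟩, ?_, fun k => ?_⟩, fun k => ?_⟩
  · rw [withDensity_apply _ MeasurableSet.univ, Measure.restrict_univ,
      ← ofReal_integral_eq_lintegral_ofReal (by simpa using hfi 0) hf0, h1, ENNReal.ofReal_one]
  · rw [withDensity_apply _ hS.compl, lintegral_eq_zero_iff hm, EventuallyEq,
      ae_restrict_iff' hS.compl]
    filter_upwards [hfS] with x hx hxS
    simp [hx hxS]
  · rw [integrable_withDensity_iff_integrable_smul' hm htop]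
    exact (hfi k).congr (hcongr k).symm
  · rw [moment, integral_withDensity_eq_integral_toReal_smul hm htop]
    exact integral_congr_ae (hcongr k)

/-! ### The next moment -/

/-- The values of the moment of order `k + 1` given the first `k` moments. -/
def nextRange (T : Set ℝ) {k : ℕ} (m : Fin k → ℝ) : Set ℝ :=
  {y | ∃ μ ∈ probMeasures T, (∀ j : Fin k, moment μ (j + 1) = m j) ∧ y = moment μ (k + 1)}

/-- The greatest lower bound of the next moment. -/
noncomputable def infNext (T : Set ℝ) {k : ℕ} (m : Fin k → ℝ) : ℝ := sInf (nextRange T m)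

/-- The least upper bound of the next moment. -/
noncomputable def supNext (T : Set ℝ) {k : ℕ} (m : Fin k → ℝ) : ℝ := sSup (nextRange T m)

/-- The first `i` coordinates of a moment vector. -/
def initial {n : ℕ} (m : Fin n → ℝ) (i : Fin n) : Fin i → ℝ := fun j => m (j.castLE i.2.le)

theorem momentRange_eq (T : Set ℝ) {n : ℕ} (m : Fin n → ℝ) (i : Fin n) :
    momentRange T m i = nextRange T (initial m i) := by
  ext y
  refine exists_congr fun μ => and_congr_right fun _ => and_congr_left fun _ => ⟨fun h j => ?_,
    fun h j hj => ?_⟩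
  · exact h (j.castLE i.2.le) (by simp [Fin.lt_def])
  · exact h ⟨j, hj⟩

theorem lowerMoment_eq (T : Set ℝ) {n : ℕ} (m : Fin n → ℝ) (i : Fin n) :
    lowerMoment T m i = infNext T (initial m i) := by
  rw [lowerMoment, momentRange_eq, infNext]

theorem upperMoment_eq (T : Set ℝ) {n : ℕ} (m : Fin n → ℝ) (i : Fin n) :
    upperMoment T m i = supNext T (initial m i) := by
  rw [upperMoment, momentRange_eq, supNext]

theorem initial_castSucc {n : ℕ} (m : Fin (n + 1) → ℝ) (i : Fin n) :
    initial m i.castSucc = initial (Fin.init m) i := rfl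

theorem initial_last {n : ℕ} (m : Fin (n + 1) → ℝ) :
    initial m (Fin.last n) = Fin.init m := rfl

theorem nextRange_nonempty {T : Set ℝ} {k : ℕ} {m : Fin k → ℝ} (hm : m ∈ momentSpace T k) :
    (nextRange T m).Nonempty := by
  obtain ⟨μ, hμ, h⟩ := hm
  exact ⟨_, μ, hμ, fun j => (h j).symm, rfl⟩

theorem bddBelow_nextRange {T : Set ℝ} (hT : T ⊆ Ici 0) {k : ℕ} (m : Fin k → ℝ) :
    BddBelow (nextRange T m) := by
  refine ⟨0, ?_⟩
  rintro _ ⟨μ, hμ, -, rfl⟩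
  exact moment_nonneg hT hμ _

theorem bddAbove_nextRange (d : ℝ) {k : ℕ} (m : Fin k → ℝ) :
    BddAbove (nextRange (Icc 0 d) m) := by
  refine ⟨d ^ (k + 1), ?_⟩
  rintro _ ⟨μ, hμ, -, rfl⟩
  exact moment_le_pow hμ _

theorem nextRange_mono {S T : Set ℝ} (h : S ⊆ T) {k : ℕ} (m : Fin k → ℝ) :
    nextRange S m ⊆ nextRange T m := by
  rintro y ⟨μ, hμ, hy⟩
  exact ⟨μ, probMeasures_mono h hμ, hy⟩

theorem momentSpace_mono {S T : Set ℝ} (h : S ⊆ T) (k : ℕ) :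
    momentSpace S k ⊆ momentSpace T k := by
  rintro y ⟨μ, hμ, hy⟩
  exact ⟨μ, probMeasures_mono h hμ, hy⟩

theorem mix_mem_nextRange {T : Set ℝ} {k : ℕ} {m m' : Fin k → ℝ} {y y' : ℝ}
    (hy : y ∈ nextRange T m) (hy' : y' ∈ nextRange T m') {a b : ℝ} (ha : 0 ≤ a) (hb : 0 ≤ b)
    (hab : a + b = 1) : a * y + b * y' ∈ nextRange T (a • m + b • m') := by
  obtain ⟨μ, hμ, h, rfl⟩ := hy
  obtain ⟨ν, hν, h', rfl⟩ := hy'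
  obtain ⟨ρ, hρ, hm⟩ := exists_mixture hμ hν ha hb hab
  exact ⟨ρ, hρ, fun j => by simp [hm, h, h'], by rw [hm]⟩

theorem convex_momentSpace (T : Set ℝ) (k : ℕ) : Convex ℝ (momentSpace T k) := by
  rintro m ⟨μ, hμ, h⟩ m' ⟨ν, hν, h'⟩ a b ha hb hab
  obtain ⟨ρ, hρ, hm⟩ := exists_mixture hμ hν ha hb hab
  exact ⟨ρ, hρ, fun j => by simp [hm, h, h']⟩

theorem convex_nextRange (T : Set ℝ) {k : ℕ} (m : Fin k → ℝ) : Convex ℝ (nextRange T m) := by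
  intro y hy y' hy' a b ha hb hab
  have := mix_mem_nextRange hy hy' ha hb hab
  rwa [← add_smul, hab, one_smul] at this

/-- Mixing near-optimal measures gives convexity. Its purpose is continuity of the lower bound in
the interior of the moment space. -/
theorem convexOn_infNext {T : Set ℝ} (hT : T ⊆ Ici 0) (k : ℕ) :
    ConvexOn ℝ (momentSpace T k) (infNext T) := by
  refine ⟨convex_momentSpace T k, fun m hm m' hm' a b ha hb hab => ?_⟩
  refine le_of_forall_pos_le_add fun ε hε => ?_
  obtain ⟨y, hy, hlt⟩ := Real.lt_sInf_add_pos (nextRange_nonempty hm) hε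
  obtain ⟨y', hy', hlt'⟩ := Real.lt_sInf_add_pos (nextRange_nonempty hm') hε
  calc infNext T (a • m + b • m') ≤ a * y + b * y' :=
        csInf_le (bddBelow_nextRange hT _) (mix_mem_nextRange hy hy' ha hb hab)
    _ ≤ a * (infNext T m + ε) + b * (infNext T m' + ε) := by
        unfold infNext; gcongr
    _ = a • infNext T m + b • infNext T m' + ε := by
        simp only [smul_eq_mul]; linear_combination ε * hab

/-! ### Regular moment vectors -/

/-- The vectors all of whose coordinates exceed the lower bound on `[0,∞)`. -/
def regularMoments (n : ℕ) : Set (Fin n → ℝ) := {m | ∀ i, lowerMoment (Ici 0) m i < m i}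

theorem mem_regularMoments_succ {n : ℕ} {m : Fin (n + 1) → ℝ} :
    m ∈ regularMoments (n + 1) ↔
      Fin.init m ∈ regularMoments n ∧ infNext (Ici 0) (Fin.init m) < m (Fin.last n) := by
  simp only [regularMoments, mem_ofPred_eq, lowerMoment_eq, Fin.forall_fin_succ',
    initial_castSucc, initial_last]
  rfl

theorem initial_mem_regularMoments {n : ℕ} {m : Fin n → ℝ} (hm : m ∈ regularMoments n)
    (i : Fin n) : initial m i ∈ regularMoments i := by
  intro j
  have h := hm (j.castLE i.2.le)
  rw [lowerMoment_eq] at h ⊢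
  exact h

/-- A small mass placed far out at `x` barely changes the first `k` moments but makes the next one
large. The correction needed to restore `m` tends to zero, so the corrected vector stays in the
moment space because `m` is an interior point. -/
theorem exists_lt_mem_nextRange {k : ℕ} {m : Fin k → ℝ}
    (hm : m ∈ interior (momentSpace (Ici 0) k)) (B : ℝ) :
    ∃ y ∈ nextRange (Ici 0) m, B < y := by
  wlog hB : 0 < B generalizing B
  · obtain ⟨y, hy, h⟩ := this 1 one_pos
    exact ⟨y, hy, by linarith⟩
  -- The mass at `x`: it contributes exactly `B + 1` to the moment of order `k + 1` and a vanishing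
  -- amount to the lower ones.
  set e : ℝ → ℝ := fun x => (B + 1) / x ^ (k + 1)
  have he : Tendsto e atTop (𝓝 0) :=
    tendsto_const_nhds.div_atTop (tendsto_pow_atTop (by omega))
  have hv : Tendsto (fun x (j : Fin k) => (m j - e x * x ^ ((j : ℕ) + 1)) / (1 - e x)) atTop
      (𝓝 m) := by
    rw [tendsto_pi_nhds]
    intro j
    have h1 : Tendsto (fun x => e x * x ^ ((j : ℕ) + 1)) atTop (𝓝 0) := by
      have := (tendsto_pow_div_pow_atTop_zero (𝕜 := ℝ)
        (show (j : ℕ) + 1 < k + 1 by omega)).const_mul (B + 1)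
      rw [mul_zero] at this
      exact this.congr fun x => by simp only [e]; ring
    have := (tendsto_const_nhds (x := m j)).sub h1 |>.div
      ((tendsto_const_nhds (x := (1 : ℝ))).sub he) (by simp)
    simpa [Pi.div_def] using this
  obtain ⟨x, hx, hx0, hx1⟩ := ((hv.eventually (mem_interior_iff_mem_nhds.1 hm)).and
    ((eventually_gt_atTop 0).and (he.eventually_lt_const one_pos))).exists
  have hx0' : x ^ (k + 1) ≠ 0 := (pow_pos hx0 _).ne'
  have he0 : 0 ≤ e x := by positivity
  obtain ⟨y, hy⟩ := nextRange_nonempty hx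
  have hd : x ^ (k + 1) ∈ nextRange (Ici 0) fun j : Fin k => x ^ ((j : ℕ) + 1) :=
    ⟨_, dirac_mem_probMeasures (mem_Ici.2 hx0.le), fun j => moment_dirac _ _,
      (moment_dirac _ _).symm⟩
  have hmix := mix_mem_nextRange hy hd (sub_nonneg.2 hx1.le) he0 (by ring)
  have hy0 : 0 ≤ y := by
    obtain ⟨μ, hμ, -, rfl⟩ := hy
    exact moment_nonneg le_rfl hμ _
  have hm' : (1 - e x) • (fun j : Fin k => (m j - e x * x ^ ((j : ℕ) + 1)) / (1 - e x)) +
      e x • (fun j : Fin k => x ^ ((j : ℕ) + 1)) = m := by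
    ext j
    have : 1 - e x ≠ 0 := by linarith
    simp only [Pi.add_apply, Pi.smul_apply, smul_eq_mul]
    field_simp
    ring
  rw [hm'] at hmix
  refine ⟨_, hmix, ?_⟩
  · have : e x * x ^ (k + 1) = B + 1 := div_mul_cancel₀ _ hx0'
    rw [this]
    nlinarith [mul_nonneg (sub_nonneg.2 hx1.le) hy0]

theorem mem_nextRange_of_infNext_lt {k : ℕ} {m : Fin k → ℝ}
    (hm : m ∈ interior (momentSpace (Ici 0) k)) {y : ℝ} (hy : infNext (Ici 0) m < y) :
    y ∈ nextRange (Ici 0) m := by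
  obtain ⟨b, hb, hyb⟩ := exists_lt_mem_nextRange hm y
  obtain ⟨a, ha, hay⟩ := exists_lt_of_csInf_lt (nextRange_nonempty (interior_subset hm)) hy
  exact (convex_nextRange _ _).ordConnected.out ha hb ⟨hay.le, hyb.le⟩

theorem continuousOn_infNext (k : ℕ) :
    ContinuousOn (infNext (Ici 0)) (interior (momentSpace (Ici 0) k)) :=
  (convexOn_infNext le_rfl k).continuousOn_interior

theorem mem_momentSpace_succ {T : Set ℝ} {k : ℕ} {m : Fin (k + 1) → ℝ} :
    m ∈ momentSpace T (k + 1) ↔ m (Fin.last k) ∈ nextRange T (Fin.init m) := by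
  refine exists_congr fun μ => and_congr_right fun _ => ?_
  rw [Fin.forall_fin_succ']
  exact and_congr_left fun _ => forall_congr' fun j => eq_comm

theorem continuous_init (n : ℕ) :
    Continuous (fun m : Fin (n + 1) → ℝ => (Fin.init m : Fin n → ℝ)) :=
  continuous_pi fun j => continuous_apply j.castSucc

/-- The two claims need a joint induction: openness at level `n + 1` uses continuity of the lower
bound, known only in the interior of the moment space, and openness with inclusion at level `n` puts
regular vectors there. -/
theorem isOpen_regularMoments_and_subset (n : ℕ) :
    IsOpen (regularMoments n) ∧ regularMoments n ⊆ momentSpace (Ici 0) n := by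
  induction n with
  | zero =>
    refine ⟨?_, fun m _ => ?_⟩
    · convert isOpen_univ
      exact eq_univ_of_forall fun m i => i.elim0
    · exact ⟨_, dirac_mem_probMeasures (mem_Ici.2 le_rfl), fun i => i.elim0⟩
  | succ n ih =>
    have hint := ih.1.subset_interior_iff.2 ih.2
    have hset : regularMoments (n + 1) = {m : Fin (n + 1) → ℝ | Fin.init m ∈ regularMoments n} ∩
        {m | infNext (Ici 0) (Fin.init m) < m (Fin.last n)} := by
      ext m; exact mem_regularMoments_succ
    refine ⟨?_, fun m hm => ?_⟩
    · have hopen : IsOpen {m : Fin (n + 1) → ℝ | Fin.init m ∈ regularMoments n} :=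
        ih.1.preimage (continuous_init n)
      have hc : ContinuousOn (fun m : Fin (n + 1) → ℝ =>
          m (Fin.last n) - infNext (Ici 0) (Fin.init m))
          {m | Fin.init m ∈ regularMoments n} :=
        (continuous_apply _).continuousOn.sub
          ((continuousOn_infNext n).comp (continuous_init n).continuousOn
            fun m hm => hint hm)
      rw [hset]
      convert hc.isOpen_inter_preimage hopen isOpen_Ioi (t := Ioi 0) using 2
      ext m
      simp
    · obtain ⟨h1, h2⟩ := mem_regularMoments_succ.1 hm
      exact mem_momentSpace_succ.2 (mem_nextRange_of_infNext_lt (hint h1) h2)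

theorem isOpen_regularMoments (n : ℕ) : IsOpen (regularMoments n) :=
  (isOpen_regularMoments_and_subset n).1

theorem regularMoments_subset_interior (n : ℕ) :
    regularMoments n ⊆ interior (momentSpace (Ici 0) n) :=
  (isOpen_regularMoments n).subset_interior_iff.2 (isOpen_regularMoments_and_subset n).2

/-! ### Compactly supported representing measures -/

theorem tendsto_setIntegral_Icc {μ : Measure ℝ} (hμ : μ ∈ probMeasures (Ici 0)) (k : ℕ) :
    Tendsto (fun d : ℝ => ∫ x, (Icc 0 d).indicator (fun x => x ^ k) x ∂μ) atTop
      (𝓝 (moment μ k)) := by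
  refine tendsto_integral_filter_of_dominated_convergence (fun x => ‖x ^ k‖) ?_ ?_
    (hμ.2.2 k).norm ?_
  · exact Eventually.of_forall fun d =>
      ((measurable_id.pow_const k).indicator measurableSet_Icc).aestronglyMeasurable
  · exact Eventually.of_forall fun d => Eventually.of_forall fun x =>
      norm_indicator_le_norm_self _ _
  · filter_upwards [ae_mem_of_mem_probMeasures hμ] with x hx
    refine tendsto_const_nhds.congr' ?_
    filter_upwards [eventually_ge_atTop x] with d hd
    rw [indicator_of_mem (show x ∈ Icc 0 d from ⟨hx, hd⟩)]

/-- Conditioning a measure on `[0,d]` gives moments that converge to the original ones. -/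
theorem momentSpace_Ici_subset_closure (n : ℕ) :
    momentSpace (Ici 0) n ⊆ closure (⋃ d : ℝ, momentSpace (Icc 0 d) n) := by
  rintro m ⟨μ, hμ, hm⟩
  have hlim := tendsto_setIntegral_Icc hμ
  have h0 : Tendsto (fun d : ℝ => ∫ x, (Icc 0 d).indicator (fun x => x ^ 0) x ∂μ) atTop (𝓝 1) := by
    simpa only [moment_zero_of_mem hμ] using hlim 0
  have hT : Tendsto (fun (d : ℝ) (j : Fin n) =>
      (∫ x, (Icc 0 d).indicator (fun x => x ^ ((j : ℕ) + 1)) x ∂μ) /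
        ∫ x, (Icc 0 d).indicator (fun x => x ^ 0) x ∂μ) atTop (𝓝 m) := by
    rw [tendsto_pi_nhds]
    intro j
    have := (hlim (j + 1)).div h0 one_ne_zero
    simpa [hm j, Pi.div_def] using this
  refine mem_closure_of_tendsto hT ?_
  filter_upwards [h0.eventually_const_lt one_pos] with d hd
  set c := ∫ x, (Icc 0 d).indicator (fun x => x ^ 0) x ∂μ with hc
  have hfun : ∀ (k : ℕ) (x : ℝ), (Icc 0 d).indicator (fun _ => c⁻¹) x * x ^ k =
      c⁻¹ * (Icc 0 d).indicator (fun x => x ^ k) x := fun k x => by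
    by_cases hx : x ∈ Icc 0 d <;> simp [hx]
  obtain ⟨ν, hν, hνm⟩ := exists_tilted (S := Icc 0 d) measurableSet_Icc (f := (Icc 0 d).indicator fun _ => c⁻¹)
    (measurable_const.indicator measurableSet_Icc)
    (Eventually.of_forall fun x => indicator_nonneg (fun _ _ => (inv_pos.2 hd).le) x)
    (Eventually.of_forall fun x hx => indicator_of_notMem hx _)
    (fun k => by
      simp only [hfun]
      exact ((hμ.2.2 k).indicator measurableSet_Icc).const_mul _)
    (by
      have := hfun 0
      simp only [pow_zero, mul_one] at this
      simp only [this, integral_const_mul]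
      simp only [pow_zero] at hc
      rw [← hc, inv_mul_cancel₀ hd.ne'])
  refine mem_iUnion.2 ⟨d, ν, hν, fun j => ?_⟩
  simp only [hνm, hfun, integral_const_mul]
  rw [div_eq_inv_mul]

theorem convex_iUnion_momentSpace_Icc (n : ℕ) :
    Convex ℝ (⋃ d : ℝ, momentSpace (Icc 0 d) n) :=
  (Monotone.directed_le fun _ _ h => momentSpace_mono (Icc_subset_Icc_right h) n).convex_iUnion
    fun _ => convex_momentSpace _ n

/-- An open set in the closure of a convex set with nonempty interior lies in that set. The interior
is nonempty because the affine span of the union is closed, so it contains an open set and is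
everything. -/
theorem regularMoments_subset_iUnion (n : ℕ) :
    regularMoments n ⊆ ⋃ d : ℝ, momentSpace (Icc 0 d) n := by
  intro m hm
  set K := ⋃ d : ℝ, momentSpace (Icc 0 d) n
  have hcl : regularMoments n ⊆ closure K :=
    ((regularMoments_subset_interior n).trans interior_subset).trans
      (momentSpace_Ici_subset_closure n)
  have hspan : affineSpan ℝ K = ⊤ := by
    refine top_unique ?_
    rw [← (isOpen_regularMoments n).affineSpan_eq_top ⟨m, hm⟩, affineSpan_le]
    exact hcl.trans (closure_minimal (subset_affineSpan _ _)
      (affineSpan ℝ K).closed_of_finiteDimensional)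
  have hK := convex_iUnion_momentSpace_Icc n
  have hint := hK.interior_nonempty_iff_affineSpan_eq_top.2 hspan
  refine interior_subset (s := K) ?_
  rw [← hK.interior_closure_eq_interior_of_nonempty_interior hint]
  exact (isOpen_regularMoments n).subset_interior_iff.2 hcl hm

/-- Enclose `m` in a simplex with regular vertices: finitely many vertices share one interval
`[0,D]`, and convexity covers the whole simplex. -/
theorem exists_eventually_mem_momentSpace_Icc {n : ℕ} {m : Fin n → ℝ}
    (hm : m ∈ regularMoments n) :
    ∃ D : ℝ, ∀ᶠ m' in 𝓝 m, m' ∈ momentSpace (Icc 0 D) n := by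
  obtain ⟨b, hb, hbs⟩ := exists_mem_interior_convexHull_affineBasis
    ((isOpen_regularMoments n).mem_nhds hm)
  have hv : ∀ i, ∃ d : ℝ, b i ∈ momentSpace (Icc 0 d) n := fun i =>
    mem_iUnion.1 (regularMoments_subset_iUnion n (hbs (subset_convexHull ℝ _ ⟨i, rfl⟩)))
  choose d hd using hv
  obtain ⟨D, hD⟩ := (finite_range d).bddAbove
  refine ⟨D, mem_of_superset (mem_interior_iff_mem_nhds.1 hb)
    (convexHull_min ?_ (convex_momentSpace _ n))⟩
  rintro _ ⟨i, rfl⟩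
  exact momentSpace_mono (Icc_subset_Icc_right (hD ⟨i, rfl⟩)) n (hd i)

/-! ### Bounds of the next moment on large intervals -/

theorem snoc_mem_regularMoments {k : ℕ} {m : Fin k → ℝ} (hm : m ∈ regularMoments k) {y : ℝ}
    (hy : infNext (Ici 0) m < y) :
    (Fin.snoc m y : Fin (k + 1) → ℝ) ∈ regularMoments (k + 1) :=
  mem_regularMoments_succ.2 (by simpa using ⟨hm, hy⟩)

theorem eventually_mem_momentSpace_Icc {n : ℕ} {m : Fin n → ℝ} (hm : m ∈ regularMoments n) :
    ∀ᶠ d : ℝ in atTop, m ∈ momentSpace (Icc 0 d) n := by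
  obtain ⟨D, hD⟩ := mem_iUnion.1 (regularMoments_subset_iUnion n hm)
  filter_upwards [eventually_ge_atTop D] with d hd
  exact momentSpace_mono (Icc_subset_Icc_right hd) n hD

theorem infNext_Ici_le_infNext_Icc {k : ℕ} {m : Fin k → ℝ} {d : ℝ}
    (hm : m ∈ momentSpace (Icc 0 d) k) : infNext (Ici 0) m ≤ infNext (Icc 0 d) m :=
  csInf_le_csInf (bddBelow_nextRange le_rfl m) (nextRange_nonempty hm)
    (nextRange_mono Icc_subset_Ici_self m)

theorem tendsto_infNext_Icc {k : ℕ} {m : Fin k → ℝ} (hm : m ∈ regularMoments k) :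
    Tendsto (fun d : ℝ => infNext (Icc 0 d) m) atTop (𝓝 (infNext (Ici 0) m)) := by
  refine tendsto_order.2 ⟨fun a ha => ?_, fun a ha => ?_⟩
  · filter_upwards [eventually_mem_momentSpace_Icc hm] with d hd
    exact ha.trans_le (infNext_Ici_le_infNext_Icc hd)
  -- Appending any `y` above the infimum gives a regular vector, which is represented on some
  -- bounded interval.
  · obtain ⟨y, hy, hya⟩ := exists_between ha
    filter_upwards [eventually_mem_momentSpace_Icc (snoc_mem_regularMoments hm hy)] with d hd
    refine lt_of_le_of_lt (csInf_le (bddBelow_nextRange Icc_subset_Ici_self m) ?_) hya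
    simpa using mem_momentSpace_succ.1 hd

/-- The excess of the last coordinate over its lower bound on `[0,∞)`. -/
noncomputable def topGap : {n : ℕ} → (Fin n → ℝ) → ℝ
  | 0, _ => 1
  | n + 1, m => m (Fin.last n) - infNext (Ici 0) (Fin.init m)

theorem topGap_pos {n : ℕ} {m : Fin n → ℝ} (hm : m ∈ regularMoments n) : 0 < topGap m := by
  cases n with
  | zero => exact one_pos
  | succ n => exact sub_pos.2 (mem_regularMoments_succ.1 hm).2

theorem prevGap_eq {n : ℕ} (m : Fin n → ℝ) (i : Fin n) : prevGap m i = topGap (initial m i) := by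
  obtain ⟨i, hi⟩ := i
  cases i with
  | zero => simp [prevGap, topGap]
  | succ i =>
    simp only [prevGap, topGap, lowerMoment_eq]
    rw [if_neg (by simp)]
    rfl

theorem supNext_Icc_zero {d : ℝ} (hd : 0 ≤ d) (m : Fin 0 → ℝ) : supNext (Icc 0 d) m = d := by
  refine IsGreatest.csSup_eq ⟨⟨_, dirac_mem_probMeasures (right_mem_Icc.2 hd),
    fun i => i.elim0, by simp [moment_dirac]⟩, ?_⟩
  rintro _ ⟨μ, hμ, -, rfl⟩
  simpa using moment_le_pow hμ 1

/-- Reweighting a measure on `[0,d]` by `1 - x/d ≥ 0` turns each moment `m_j` into `m_j -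
m_{j+1}/d`, up to normalization. The lower bound on `[0,∞)` for the reweighted measure is an upper
bound for the next moment of the original one. -/
theorem le_of_mem_nextRange_Icc {k : ℕ} {m : Fin (k + 1) → ℝ} {d : ℝ} (hd : 0 < d)
    (hmd : m 0 < d) {y : ℝ} (hy : y ∈ nextRange (Icc 0 d) m) :
    y / d ≤ m (Fin.last k) - (1 - m 0 / d) *
      infNext (Ici 0) fun j : Fin k => (m j.castSucc - m j.succ / d) / (1 - m 0 / d) := by
  obtain ⟨μ, hμ, hm, rfl⟩ := hy
  have := hμ.1
  set c := 1 - m 0 / d with hc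
  have hc0 : 0 < c := sub_pos.2 ((div_lt_one hd).2 hmd)
  have hfun : ∀ (k : ℕ) (x : ℝ), (1 - x / d) / c * x ^ k = (x ^ k - x ^ (k + 1) / d) / c :=
    fun k x => by ring
  have hi : ∀ k : ℕ, Integrable (fun x : ℝ => (1 - x / d) / c * x ^ k) μ := fun k => by
    simp only [hfun]
    exact ((hμ.2.2 k).sub ((hμ.2.2 (k + 1)).div_const d)).div_const c
  have hint : ∀ k : ℕ, ∫ x, (1 - x / d) / c * x ^ k ∂μ =
      (moment μ k - moment μ (k + 1) / d) / c := fun k => by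
    simp only [hfun]
    rw [integral_div, integral_sub (hμ.2.2 k) ((hμ.2.2 (k + 1)).div_const d), integral_div]
    rfl
  have hm0 : moment μ 1 = m 0 := by simpa using hm 0
  obtain ⟨ν, hν, hνm⟩ := exists_tilted measurableSet_Ici (μ := μ) (S := Ici 0)
    (f := fun x => (1 - x / d) / c) (by fun_prop)
    (by
      filter_upwards [ae_mem_of_mem_probMeasures hμ] with x hx
      exact div_nonneg (sub_nonneg.2 ((div_le_one hd).2 hx.2)) hc0.le)
    (by
      filter_upwards [ae_mem_of_mem_probMeasures hμ] with x hx h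
      exact absurd hx.1 h) hi
    (by
      have := hint 0
      simp only [pow_zero, mul_one, zero_add, moment_zero_of_mem hμ, hm0] at this
      rw [this, ← hc, div_self hc0.ne'])
  have hle : infNext (Ici 0) (fun j : Fin k => (m j.castSucc - m j.succ / d) / c) ≤
      (m (Fin.last k) - moment μ (k + 1 + 1) / d) / c := by
    refine csInf_le (bddBelow_nextRange le_rfl _) ⟨ν, hν, fun j => ?_, ?_⟩
    · rw [hνm, hint]
      simp only [← hm]
      rfl
    · rw [hνm, hint, ← hm]
      rfl
  rw [le_div_iff₀ hc0] at hle
  linarith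

/-- From below, an atom at `d` that uses up almost all of the excess of the last coordinate makes
the next moment of order `d` times that excess. From above, the reweighting bound converges by
continuity of `infNext`. -/
theorem tendsto_supNext_Icc_div {n : ℕ} {m : Fin n → ℝ} (hm : m ∈ regularMoments n) :
    Tendsto (fun d : ℝ => supNext (Icc 0 d) m / d) atTop (𝓝 (topGap m)) := by
  cases n with
  | zero =>
    refine tendsto_const_nhds.congr' ?_
    filter_upwards [eventually_gt_atTop 0] with d hd
    rw [supNext_Icc_zero hd.le, div_self hd.ne', topGap]
  | succ k =>
  obtain ⟨hm', hlt⟩ := mem_regularMoments_succ.1 hm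
  refine tendsto_order.2 ⟨fun a ha => ?_, fun a ha => ?_⟩
  -- The atom at `d` gets mass `s / d ^ (k + 1)`, contributing `s` to the last prescribed moment and
  -- `s * d` to the next. Since `s` is below the gap, the remainder tends to a regular vector and is
  -- eventually representable on a fixed `[0,D]`.
  · obtain ⟨s, hs, hsg⟩ := exists_between (max_lt ha (topGap_pos hm))
    obtain ⟨has, hs0⟩ := max_lt_iff.1 hs
    have hreg : (Fin.snoc (Fin.init m) (m (Fin.last k) - s) : Fin (k + 1) → ℝ) ∈
        regularMoments (k + 1) := by
      refine snoc_mem_regularMoments hm' ?_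
      simp only [topGap] at hsg
      linarith
    obtain ⟨D, hD⟩ := exists_eventually_mem_momentSpace_Icc hreg
    set e : ℝ → ℝ := fun d => s / d ^ (k + 1) with he_def
    have he : Tendsto e atTop (𝓝 0) :=
      tendsto_const_nhds.div_atTop (tendsto_pow_atTop (by omega))
    have hw : Tendsto (fun d (j : Fin (k + 1)) => (m j - e d * d ^ ((j : ℕ) + 1)) / (1 - e d))
        atTop (𝓝 (Fin.snoc (Fin.init m) (m (Fin.last k) - s) : Fin (k + 1) → ℝ)) := by
      rw [tendsto_pi_nhds]
      have hdiv : ∀ (j : Fin (k + 1)) (l : ℝ),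
          Tendsto (fun d => e d * d ^ ((j : ℕ) + 1)) atTop (𝓝 l) →
          Tendsto (fun d => (m j - e d * d ^ ((j : ℕ) + 1)) / (1 - e d)) atTop (𝓝 (m j - l)) := by
        intro j l h1
        have := (tendsto_const_nhds (x := m j)).sub h1 |>.div
          ((tendsto_const_nhds (x := (1 : ℝ))).sub he) (by simp)
        simpa [Pi.div_def] using this
      refine Fin.lastCases ?_ fun j => ?_
      · rw [Fin.snoc_last]
        refine hdiv _ _ (tendsto_const_nhds.congr' ?_)
        filter_upwards [eventually_gt_atTop 0] with d hd
        exact (div_mul_cancel₀ _ (pow_pos hd _).ne').symm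
      · rw [Fin.snoc_castSucc]
        have h1 : Tendsto (fun d => e d * d ^ ((j : ℕ) + 1)) atTop (𝓝 0) := by
          have := (tendsto_pow_div_pow_atTop_zero (𝕜 := ℝ)
            (show (j : ℕ) + 1 < k + 1 by omega)).const_mul s
          rw [mul_zero] at this
          exact this.congr fun x => by simp only [e]; ring
        simpa [Fin.init] using hdiv j.castSucc 0 h1
    filter_upwards [hw.eventually hD, eventually_ge_atTop D, eventually_gt_atTop 0,
      he.eventually_lt_const one_pos] with d hd hdD hd0 hd1
    have he0 : 0 ≤ e d := by positivity
    obtain ⟨y, hy⟩ := nextRange_nonempty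
      (momentSpace_mono (Icc_subset_Icc_right hdD) _ hd)
    have hdir : d ^ (k + 1 + 1) ∈ nextRange (Icc 0 d)
        fun j : Fin (k + 1) => d ^ ((j : ℕ) + 1) :=
      ⟨_, dirac_mem_probMeasures (right_mem_Icc.2 hd0.le), fun j => moment_dirac _ _,
        (moment_dirac _ _).symm⟩
    have hmix := mix_mem_nextRange hy hdir (sub_nonneg.2 hd1.le) he0 (by ring)
    have hy0 : 0 ≤ y := by
      obtain ⟨μ, hμ, -, rfl⟩ := hy
      exact moment_nonneg Icc_subset_Ici_self hμ _
    have hmm : (1 - e d) • (fun j : Fin (k + 1) => (m j - e d * d ^ ((j : ℕ) + 1)) / (1 - e d)) +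
        e d • (fun j : Fin (k + 1) => d ^ ((j : ℕ) + 1)) = m := by
      ext j
      have : 1 - e d ≠ 0 := by linarith
      simp only [Pi.add_apply, Pi.smul_apply, smul_eq_mul]
      field_simp
      ring
    rw [hmm] at hmix
    have hle : (1 - e d) * y + e d * d ^ (k + 1 + 1) ≤ supNext (Icc 0 d) m :=
      le_csSup (bddAbove_nextRange d m) hmix
    have hed : e d * d ^ (k + 1 + 1) = s * d := by
      rw [pow_succ _ (k + 1), ← mul_assoc, div_mul_cancel₀ _ (pow_pos hd0 _).ne']
    refine has.trans_le ((le_div_iff₀ hd0).2 ?_)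
    nlinarith [mul_nonneg (sub_nonneg.2 hd1.le) hy0]
  · have hinv : ∀ b : ℝ, Tendsto (fun d : ℝ => b / d) atTop (𝓝 0) := fun b =>
      tendsto_const_nhds.div_atTop tendsto_id
    have hc : Tendsto (fun d => 1 - m 0 / d) atTop (𝓝 1) := by
      simpa using tendsto_const_nhds.sub (hinv (m 0))
    have hu : Tendsto (fun (d : ℝ) (j : Fin k) =>
        (m j.castSucc - m j.succ / d) / (1 - m 0 / d)) atTop (𝓝 (Fin.init m)) := by
      rw [tendsto_pi_nhds]
      intro j
      have := (tendsto_const_nhds (x := m j.castSucc)).sub (hinv (m j.succ)) |>.div hc one_ne_zero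
      simpa [Pi.div_def, Fin.init] using this
    have hL := ((continuousOn_infNext k).continuousAt
      (isOpen_interior.mem_nhds (regularMoments_subset_interior k hm'))).tendsto.comp hu
    have hb : Tendsto (fun d => m (Fin.last k) - (1 - m 0 / d) *
        infNext (Ici 0) fun j : Fin k => (m j.castSucc - m j.succ / d) / (1 - m 0 / d)) atTop
        (𝓝 (topGap m)) := by
      simpa [topGap] using tendsto_const_nhds.sub (hc.mul hL)
    filter_upwards [hb.eventually_lt_const ha, eventually_gt_atTop 0, eventually_gt_atTop (m 0),
      eventually_mem_momentSpace_Icc hm] with d hda hd0 hdm hmem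
    refine lt_of_le_of_lt ?_ hda
    rw [div_le_iff₀ hd0]
    refine csSup_le (nextRange_nonempty hmem) fun y hy => ?_
    exact (div_le_iff₀ hd0).1 (le_of_mem_nextRange_Icc hd0 hdm hy)

/-! ### Asymptotics of Beta integrals -/

theorem integrableOn_rpow_mul_exp {a b : ℝ} (ha : -1 < a) (hb : 0 < b) :
    IntegrableOn (fun t : ℝ => t ^ a * Real.exp (-b * t)) (Ioi 0) := by
  simpa using integrableOn_rpow_mul_exp_neg_mul_rpow ha one_pos hb

theorem integral_rpow_mul_exp {a b : ℝ} (ha : -1 < a) (hb : 0 < b) :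
    ∫ t in Ioi (0 : ℝ), t ^ a * Real.exp (-b * t) = Real.Gamma (a + 1) / b ^ (a + 1) := by
  have := Real.integral_rpow_mul_exp_neg_mul_Ioi (a := a + 1) (by linarith) hb
  simp only [add_sub_cancel_right, ← neg_mul] at this
  rw [this, one_div, Real.inv_rpow hb.le, inv_mul_eq_div]

/-- The logarithm is `(β d / d) * (d * log (1 - p d))`, whose factors tend to `b` and `-z`. -/
theorem tendsto_one_sub_rpow {p β : ℝ → ℝ} {z b : ℝ}
    (hp : Tendsto (fun d => d * p d) atTop (𝓝 z))
    (hβ : Tendsto (fun d => β d / d) atTop (𝓝 b)) :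
    Tendsto (fun d => (1 - p d) ^ β d) atTop (𝓝 (Real.exp (-b * z))) := by
  have hp0 : Tendsto p atTop (𝓝 0) := by
    have := hp.mul tendsto_inv_atTop_zero
    rw [mul_zero] at this
    refine this.congr' ?_
    filter_upwards [eventually_gt_atTop 0] with d hd
    field_simp
  have hlog := Real.tendsto_mul_log_one_add_of_tendsto (g := fun d => -p d) (t := -z)
    (by simpa using hp.neg)
  have := (Real.continuous_exp.tendsto _).comp (hβ.mul hlog)
  rw [show -b * z = b * -z by ring]
  refine this.congr' ?_
  filter_upwards [eventually_gt_atTop 0, hp0.eventually_lt_const one_pos] with d hd hpd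
  rw [Real.rpow_def_of_pos (sub_pos.2 hpd), Function.comp_apply, sub_eq_add_neg]
  congr 1
  field_simp

theorem rpow_mul_integral_beta {d : ℝ} (hd : 0 < d) (a b : ℝ) :
    d ^ (a + 1) * ∫ x in (0 : ℝ)..1, x ^ a * (1 - x) ^ b =
      ∫ t in Ioi (0 : ℝ), (Ioc 0 d).indicator (fun t => t ^ a * (1 - t / d) ^ b) t := by
  have h := intervalIntegral.integral_comp_div (a := 0) (b := d)
    (fun x : ℝ => x ^ a * (1 - x) ^ b) hd.ne'
  rw [zero_div, div_self hd.ne', smul_eq_mul] at h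
  rw [Real.rpow_add_one hd.ne', mul_assoc, ← h, ← intervalIntegral.integral_const_mul,
    intervalIntegral.integral_of_le hd.le, setIntegral_indicator measurableSet_Ioc,
    inter_eq_self_of_subset_right Ioc_subset_Ioi_self]
  refine setIntegral_congr_fun measurableSet_Ioc fun t ht => ?_
  rw [Real.div_rpow ht.1.le hd.le, ← mul_assoc, mul_div_cancel₀ _ (Real.rpow_pos_of_pos hd _).ne']

theorem tendsto_rpow_mul_integral_beta {α β : ℝ → ℝ} {a b : ℝ} (ha : -1 < a) (hb : 0 < b)
    (hα : Tendsto α atTop (𝓝 a)) (hβ : Tendsto (fun d => β d / d) atTop (𝓝 b)) :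
    Tendsto (fun d => d ^ (α d + 1) * ∫ x in (0 : ℝ)..1, x ^ α d * (1 - x) ^ β d) atTop
      (𝓝 (Real.Gamma (a + 1) / b ^ (a + 1))) := by
  -- This choice keeps `a - ε > -1`, so both powers in the dominating function are integrable at
  -- `0`; one dominates for `t ≤ 1`, the other for `t ≥ 1`.
  set ε := (a + 1) / 2 with hε
  have hlo : -1 < a - ε := by linarith
  have hhi : -1 < a + ε := by linarith
  rw [← integral_rpow_mul_exp ha hb]
  refine Tendsto.congr' (f₁ := fun d => ∫ t in Ioi (0 : ℝ),
    (Ioc 0 d).indicator (fun t => t ^ α d * (1 - t / d) ^ β d) t) ?_ ?_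
  · filter_upwards [eventually_gt_atTop 0] with d hd
    exact (rpow_mul_integral_beta hd _ _).symm
  refine tendsto_integral_filter_of_dominated_convergence
    (fun t => t ^ (a - ε) * Real.exp (-(b / 2) * t) + t ^ (a + ε) * Real.exp (-(b / 2) * t))
    ?_ ?_ ?_ ?_
  · refine Eventually.of_forall fun d => Measurable.aestronglyMeasurable ?_
    exact Measurable.indicator (by fun_prop) measurableSet_Ioc
  · filter_upwards [eventually_gt_atTop 0, hα.eventually_const_lt (show a - ε < a by linarith),
      hα.eventually_lt_const (show a < a + ε by linarith),
      hβ.eventually_const_lt (show b / 2 < b by linarith)] with d hd h1 h2 h3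
    refine (ae_restrict_iff' measurableSet_Ioi).2 (Eventually.of_forall fun t ht => ?_)
    have ht0 : (0 : ℝ) < t := ht
    rw [← add_mul]
    by_cases htd : t ∈ Ioc 0 d
    · have h0 : 0 ≤ 1 - t / d := sub_nonneg.2 ((div_le_one hd).2 htd.2)
      have hβ0 : 0 < β d := by
        have := (lt_div_iff₀ hd).1 h3
        nlinarith
      rw [indicator_of_mem htd, Real.norm_of_nonneg (by positivity)]
      have hexp : (1 - t / d) ^ β d ≤ Real.exp (-(b / 2) * t) := by
        calc (1 - t / d) ^ β d ≤ Real.exp (-(t / d)) ^ β d :=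
              Real.rpow_le_rpow h0 (Real.one_sub_le_exp_neg _) hβ0.le
          _ = Real.exp (-(β d / d) * t) := by rw [← Real.exp_mul]; congr 1; ring
          _ ≤ Real.exp (-(b / 2) * t) := by
              apply Real.exp_le_exp.2
              nlinarith
      have hpow : t ^ α d ≤ t ^ (a - ε) + t ^ (a + ε) := by
        have p1 := Real.rpow_pos_of_pos ht0 (a - ε)
        have p2 := Real.rpow_pos_of_pos ht0 (a + ε)
        rcases le_total t 1 with h | h
        · linarith [Real.rpow_le_rpow_of_exponent_ge ht0 h h1.le]
        · linarith [Real.rpow_le_rpow_of_exponent_le h h2.le]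
      gcongr
    · rw [indicator_of_notMem htd, norm_zero]
      positivity
  · exact (integrableOn_rpow_mul_exp hlo (half_pos hb)).add
      (integrableOn_rpow_mul_exp hhi (half_pos hb))
  · refine (ae_restrict_iff' measurableSet_Ioi).2 (Eventually.of_forall fun t ht => ?_)
    have ht0 : (0 : ℝ) < t := ht
    have h1 : Tendsto (fun d : ℝ => t ^ α d) atTop (𝓝 (t ^ a)) :=
      tendsto_const_nhds.rpow hα (Or.inl ht0.ne')
    have h2 : Tendsto (fun d : ℝ => (1 - t / d) ^ β d) atTop (𝓝 (Real.exp (-b * t))) := by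
      refine tendsto_one_sub_rpow (tendsto_const_nhds.congr' ?_) hβ
      filter_upwards [eventually_gt_atTop 0] with d hd
      field_simp
    refine (h1.mul h2).congr' ?_
    filter_upwards [eventually_ge_atTop t] with d hd
    rw [indicator_of_mem (show t ∈ Ioc 0 d from ⟨ht0, hd⟩)]

/-! ### Pointwise convergence of the densities -/

theorem prod_Icc_one_eq_prod_fin {M : Type*} [CommMonoid M] (f : ℕ → M) (n : ℕ) :
    ∏ k ∈ Finset.Icc 1 n, f k = ∏ i : Fin n, f (i + 1) := by
  induction n with
  | zero => simp
  | succ n ih =>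
    rw [Finset.prod_Icc_succ_top (by omega), ih, Fin.prod_univ_castSucc]
    simp

theorem sum_fin_sub (n : ℕ) : ∑ i : Fin n, (n - i) = n * (n + 1) / 2 := by
  rw [Fin.sum_univ_eq_sum_range (fun i => n - i) n, ← Finset.sum_range_reflect]
  have h : ∑ j ∈ Finset.range n, (n - (n - 1 - j)) = ∑ j ∈ Finset.range n, (j + 1) :=
    Finset.sum_congr rfl fun j hj => by have := Finset.mem_range.1 hj; omega
  have h' := Finset.sum_range_succ' (fun i => i) n
  rw [h, ← add_zero (∑ j ∈ Finset.range n, (j + 1)), ← h', Finset.sum_range_id, mul_comm]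
  simp

theorem betaConst_zero_left (d : ℝ) (γ δ : ℕ → ℝ) (n : ℕ) :
    betaConst 0 d γ δ n = ∏ i : Fin n, (d ^ (n - (i : ℕ)) *
      ∫ x in (0 : ℝ)..1, x ^ ((n : ℝ) - (i + 1 : ℕ) + γ (i + 1)) *
        (1 - x) ^ ((n : ℝ) - (i + 1 : ℕ) + δ (i + 1)))⁻¹ := by
  rw [betaConst, sub_zero, prod_Icc_one_eq_prod_fin, ← sum_fin_sub, ← Finset.prod_pow_eq_pow_sum,
    ← Finset.prod_mul_distrib, Finset.prod_inv_distrib]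

theorem betaDensity_eq_zero {γ δ : ℕ → ℝ} {n : ℕ} {m : Fin n → ℝ} (hm : m ∉ regularMoments n)
    (d : ℝ) : betaDensity 0 d γ δ n m = 0 := by
  simp only [regularMoments, mem_ofPred_eq, not_forall, not_lt] at hm
  obtain ⟨i, hi⟩ := hm
  refine mul_eq_zero_of_right _ (Finset.prod_eq_zero (Finset.mem_univ i) ?_)
  rw [if_neg, mul_zero]
  rintro ⟨h1, h2⟩
  rw [lowerMoment_eq] at h1 hi
  rw [upperMoment_eq] at h2
  -- If no measure on `[0,d]` has the prescribed moments, both bounds take the default value `0` and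
  -- the indicator still vanishes.
  rcases (nextRange (Icc 0 d) (initial m i)).eq_empty_or_nonempty with h | h
  · rw [infNext, h, Real.sInf_empty] at h1
    rw [supNext, h, Real.sSup_empty] at h2
    exact lt_asymm h1 h2
  · exact absurd (hi.trans (csInf_le_csInf (bddBelow_nextRange le_rfl _) h
      (nextRange_mono Icc_subset_Ici_self _))) h1.not_ge

theorem gammaDensity_eq_zero {γ δ : ℕ → ℝ} {n : ℕ} {m : Fin n → ℝ} (hm : m ∉ regularMoments n) :
    gammaDensity γ δ n m = 0 := by
  simp only [regularMoments, mem_ofPred_eq, not_forall] at hm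
  obtain ⟨i, hi⟩ := hm
  refine mul_eq_zero_of_right _ (Finset.prod_eq_zero (Finset.mem_univ i) ?_)
  rw [if_neg hi, mul_zero]

theorem prevGap_pos {n : ℕ} {m : Fin n → ℝ} (hm : m ∈ regularMoments n) (i : Fin n) :
    0 < prevGap m i := by
  rw [prevGap_eq]
  exact topGap_pos (initial_mem_regularMoments hm i)

theorem recVar_pos {n : ℕ} {m : Fin n → ℝ} (hm : m ∈ regularMoments n) (i : Fin n) :
    0 < recVar m i :=
  div_pos (sub_pos.2 (hm i)) (prevGap_pos hm i)

/-- The constant is distributed over the coordinates because only the combined factor has a limit: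
`d ^ γd d` must cancel exactly between the Beta integral and the power of the canonical coordinate.
-/
theorem tendsto_betaDensity_factor {n : ℕ} {m : Fin n → ℝ} (hm : m ∈ regularMoments n)
    (i : Fin n) {γd δd : ℝ → ℝ} {γ δ : ℝ} (hγ : -1 < γ) (hδ : 0 < δ)
    (hγd : Tendsto γd atTop (𝓝 γ)) (hδd : Tendsto (fun d => δd d / d) atTop (𝓝 δ)) :
    Tendsto (fun d : ℝ => (d ^ (n - (i : ℕ)) *
      ∫ x in (0 : ℝ)..1, x ^ ((n : ℝ) - (i + 1 : ℕ) + γd d) *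
        (1 - x) ^ ((n : ℝ) - (i + 1 : ℕ) + δd d))⁻¹ *
      (((m i - lowerMoment (Icc 0 d) m i) /
        (upperMoment (Icc 0 d) m i - lowerMoment (Icc 0 d) m i)) ^ γd d *
      ((upperMoment (Icc 0 d) m i - m i) /
        (upperMoment (Icc 0 d) m i - lowerMoment (Icc 0 d) m i)) ^ δd d *
      (if lowerMoment (Icc 0 d) m i < m i ∧ m i < upperMoment (Icc 0 d) m i then 1 else 0))) atTop
    (𝓝 (δ ^ (γ + n - (i + 1 : ℕ) + 1) / Real.Gamma (γ + n - (i + 1 : ℕ) + 1) *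
      (((m i - lowerMoment (Ici 0) m i) / prevGap m i) ^ γ *
      Real.exp (-δ * ((m i - lowerMoment (Ici 0) m i) / prevGap m i)) *
      (if lowerMoment (Ici 0) m i < m i then 1 else 0)))) := by
  have hreg := initial_mem_regularMoments hm i
  have hgap := prevGap_pos hm i
  have hz := recVar_pos hm i
  have hlow := hm i
  rw [if_pos (hm i), mul_one]
  rw [recVar] at hz
  simp only [prevGap_eq, lowerMoment_eq, upperMoment_eq] at *
  set w := initial m i
  set L := fun d : ℝ => infNext (Icc 0 d) w
  set U := fun d : ℝ => supNext (Icc 0 d) w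
  set z := (m i - infNext (Ici 0) w) / topGap w
  have hL : Tendsto L atTop (𝓝 (infNext (Ici 0) w)) := tendsto_infNext_Icc hreg
  have hU : Tendsto (fun d => U d / d) atTop (𝓝 (topGap w)) := tendsto_supNext_Icc_div hreg
  have hLd : Tendsto (fun d => L d / d) atTop (𝓝 0) := hL.div_atTop tendsto_id
  have hp : Tendsto (fun d => d * ((m i - L d) / (U d - L d))) atTop (𝓝 z) := by
    have h := (tendsto_const_nhds (x := m i)).sub hL |>.div (hU.sub hLd)
      (by rw [sub_zero]; exact hgap.ne')
    rw [sub_zero] at h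
    refine h.congr' ?_
    filter_upwards [eventually_gt_atTop 0] with d hd
    simp only [Pi.div_apply]
    rw [← sub_div, div_div_eq_mul_div, mul_comm, mul_div_assoc]
  have hUtop : Tendsto U atTop atTop := by
    refine (Tendsto.pos_mul_atTop hgap hU tendsto_id).congr' ?_
    filter_upwards [eventually_gt_atTop 0] with d hd
    exact div_mul_cancel₀ _ hd.ne'
  have hle : (i : ℝ) + 1 ≤ n := by exact_mod_cast i.2
  have hc0 : Tendsto (fun d : ℝ => ((n : ℝ) - (i + 1 : ℕ)) / d) atTop (𝓝 0) :=
    tendsto_const_nhds.div_atTop tendsto_id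
  have hbeta := tendsto_rpow_mul_integral_beta (α := fun d => (n : ℝ) - (i + 1 : ℕ) + γd d)
    (β := fun d => (n : ℝ) - (i + 1 : ℕ) + δd d) (a := (n : ℝ) - (i + 1 : ℕ) + γ) (b := δ)
    (by push_cast; linarith) hδ (hγd.const_add _)
    (by simpa only [zero_add, add_div] using hc0.add hδd)
  have hΓ : 0 < Real.Gamma ((n : ℝ) - (i + 1 : ℕ) + γ + 1) :=
    Real.Gamma_pos_of_pos (by push_cast; linarith)
  have hlim := (hbeta.inv₀ (div_pos hΓ (Real.rpow_pos_of_pos hδ _)).ne').mul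
    ((hp.rpow hγd (Or.inl hz.ne')).mul (tendsto_one_sub_rpow hp hδd))
  rw [inv_div, show (n : ℝ) - (i + 1 : ℕ) + γ + 1 = γ + n - (i + 1 : ℕ) + 1 by ring] at hlim
  refine hlim.congr' ?_
  filter_upwards [eventually_gt_atTop 0, hL.eventually_lt_const hlow,
    hUtop.eventually_gt_atTop (m i)] with d hd h1 h2
  rw [if_pos ⟨h1, h2⟩, mul_one]
  have hUL : 0 < U d - L d := by linarith
  have hp0 : 0 < (m i - L d) / (U d - L d) := div_pos (sub_pos.2 h1) hUL
  have hq : (U d - m i) / (U d - L d) = 1 - (m i - L d) / (U d - L d) := by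
    field_simp
    ring
  -- With `k = i + 1`, the exponent `n - k + 1` from the constant is `n - i`.
  have hdp : d ^ ((n : ℝ) - (i + 1 : ℕ) + γd d + 1) = d ^ (n - (i : ℕ)) * d ^ γd d := by
    rw [← Real.rpow_natCast, ← Real.rpow_add hd, Nat.cast_sub i.2.le]
    congr 1
    push_cast
    ring
  have hdγ := (Real.rpow_pos_of_pos hd (γd d)).ne'
  rw [show supNext (Icc 0 d) w = U d from rfl, hq, hdp, Real.mul_rpow hd.le hp0.le]
  have key : ∀ A B I P Q : ℝ, B ≠ 0 → (A * B * I)⁻¹ * (B * P * Q) = (A * I)⁻¹ * (P * Q) := by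
    intro A B I P Q hB
    rw [mul_right_comm A B I, mul_inv (A * I), mul_assoc B, mul_assoc, inv_mul_cancel_left₀ hB]
  exact key _ _ _ _ _ hdγ

theorem tendsto_betaDensity {n : ℕ} {γd δd : ℝ → ℕ → ℝ} {γ δ : ℕ → ℝ}
    (hγ : ∀ k : ℕ, 1 ≤ k → -1 < γ k) (hδ : ∀ k : ℕ, 1 ≤ k → 0 < δ k)
    (hγd : ∀ k : ℕ, 1 ≤ k → Tendsto (fun d : ℝ => γd d k) atTop (𝓝 (γ k)))
    (hδd : ∀ k : ℕ, 1 ≤ k → Tendsto (fun d : ℝ => δd d k / d) atTop (𝓝 (δ k)))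
    (m : Fin n → ℝ) :
    Tendsto (fun d : ℝ => betaDensity 0 d (γd d) (δd d) n m) atTop
      (𝓝 (gammaDensity γ δ n m)) := by
  by_cases hm : m ∈ regularMoments n
  · simp only [betaDensity, gammaDensity, betaConst_zero_left, gammaConst,
      prod_Icc_one_eq_prod_fin, ← Finset.prod_mul_distrib]
    exact tendsto_finsetProd _ fun i _ => tendsto_betaDensity_factor hm i (hγ _ (by omega))
      (hδ _ (by omega)) (hγd _ (by omega)) (hδd _ (by omega))
  · simp only [betaDensity_eq_zero hm, gammaDensity_eq_zero hm]
    exact tendsto_const_nhds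

theorem lowerMoment_le_of_mem {T : Set ℝ} (hT : T ⊆ Ici 0) {n : ℕ} {m : Fin n → ℝ}
    (hm : m ∈ momentSpace T n) (i : Fin n) : lowerMoment T m i ≤ m i := by
  obtain ⟨μ, hμ, h⟩ := hm
  rw [lowerMoment_eq]
  exact csInf_le (bddBelow_nextRange hT _) ⟨μ, hμ, fun j => (h (j.castLE i.2.le)).symm, h i⟩

theorem gammaDensity_eq_recVar (γ δ : ℕ → ℝ) {n : ℕ} {m : Fin n → ℝ}
    (hm : m ∈ momentSpace (Ici 0) n) :
    gammaDensity γ δ n m = gammaConst γ δ n * ∏ i : Fin n,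
      (recVar m i ^ γ (i + 1) * Real.exp (-δ (i + 1) * recVar m i) *
        (if 0 < recVar m i then 1 else 0)) := by
  by_cases hreg : m ∈ regularMoments n
  · rw [gammaDensity]
    congr 1
    refine Finset.prod_congr rfl fun i _ => ?_
    rw [if_pos (hreg i), if_pos (recVar_pos hreg i)]
    rfl
  · rw [gammaDensity_eq_zero hreg]
    simp only [regularMoments, mem_ofPred_eq, not_forall, not_lt] at hreg
    obtain ⟨i, hi⟩ := hreg
    have h0 : recVar m i = 0 := by
      rw [recVar, le_antisymm hi (lowerMoment_le_of_mem le_rfl hm i), sub_self, zero_div]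
    refine (mul_eq_zero_of_right _ (Finset.prod_eq_zero (Finset.mem_univ i) ?_)).symm
    rw [h0, if_neg (lt_irrefl _), mul_zero]

/-! ### The total mass of the Gamma-type density -/

/-- The density `gammaDensity` without its normalizing constant. -/
noncomputable def gammaKernel (γ δ : ℕ → ℝ) (n : ℕ) (m : Fin n → ℝ) : ℝ :=
  ∏ i : Fin n,
    (((m i - lowerMoment (Ici 0) m i) / prevGap m i) ^ γ (i + 1) *
      Real.exp (-δ (i + 1) * ((m i - lowerMoment (Ici 0) m i) / prevGap m i)) *
      (if lowerMoment (Ici 0) m i < m i then 1 else 0))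

theorem gammaDensity_eq_const_mul (γ δ : ℕ → ℝ) (n : ℕ) (m : Fin n → ℝ) :
    gammaDensity γ δ n m = gammaConst γ δ n * gammaKernel γ δ n m := rfl

theorem gammaKernel_eq_zero {γ δ : ℕ → ℝ} {n : ℕ} {m : Fin n → ℝ} (hm : m ∉ regularMoments n) :
    gammaKernel γ δ n m = 0 := by
  simp only [regularMoments, mem_ofPred_eq, not_forall] at hm
  obtain ⟨i, hi⟩ := hm
  exact Finset.prod_eq_zero (Finset.mem_univ i) (by rw [if_neg hi, mul_zero])

theorem gammaKernel_of_mem (γ δ : ℕ → ℝ) {n : ℕ} {m : Fin n → ℝ} (hm : m ∈ regularMoments n) :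
    gammaKernel γ δ n m =
      ∏ i : Fin n, (recVar m i ^ γ (i + 1) * Real.exp (-δ (i + 1) * recVar m i)) := by
  refine Finset.prod_congr rfl fun i _ => ?_
  rw [if_pos (hm i), mul_one]
  rfl

theorem gammaKernel_nonneg (γ δ : ℕ → ℝ) {n : ℕ} (m : Fin n → ℝ) : 0 ≤ gammaKernel γ δ n m := by
  by_cases hm : m ∈ regularMoments n
  · rw [gammaKernel_of_mem γ δ hm]
    exact Finset.prod_nonneg fun i _ =>
      mul_nonneg (Real.rpow_nonneg (recVar_pos hm i).le _) (Real.exp_pos _).le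
  · rw [gammaKernel_eq_zero hm]

theorem continuous_initial {n : ℕ} (i : Fin n) :
    Continuous (fun m : Fin n → ℝ => initial m i) :=
  continuous_pi fun _ => continuous_apply _

theorem continuousOn_lowerMoment {n : ℕ} (i : Fin n) :
    ContinuousOn (fun m => lowerMoment (Ici 0) m i) (regularMoments n) := by
  simp only [lowerMoment_eq]
  exact (continuousOn_infNext i).comp (continuous_initial i).continuousOn fun m hm =>
    regularMoments_subset_interior i (initial_mem_regularMoments hm i)

theorem continuousOn_prevGap {n : ℕ} (i : Fin n) :
    ContinuousOn (fun m => prevGap m i) (regularMoments n) := by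
  unfold prevGap
  split_ifs
  · exact continuousOn_const
  · exact (continuous_apply _).continuousOn.sub (continuousOn_lowerMoment _)

theorem continuousOn_recVar {n : ℕ} (i : Fin n) :
    ContinuousOn (fun m => recVar m i) (regularMoments n) :=
  ((continuous_apply _).continuousOn.sub (continuousOn_lowerMoment i)).div
    (continuousOn_prevGap i) fun _ hm => (prevGap_pos hm i).ne'

theorem measurable_gammaKernel (γ δ : ℕ → ℝ) (n : ℕ) : Measurable (gammaKernel γ δ n) := by
  classical
  have hc : ContinuousOn (gammaKernel γ δ n) (regularMoments n) := by
    refine ContinuousOn.congr ?_ fun m hm => gammaKernel_of_mem γ δ hm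
    refine continuousOn_finsetProd _ fun i _ => ContinuousOn.mul ?_ ?_
    · exact (continuousOn_recVar i).rpow_const fun m hm => Or.inl (recVar_pos hm i).ne'
    · exact ((continuousOn_recVar i).const_mul _).rexp
  have := hc.measurable_piecewise (g := fun _ => 0) continuousOn_const
    (isOpen_regularMoments n).measurableSet
  convert this using 1
  ext m
  by_cases hm : m ∈ regularMoments n
  · rw [piecewise_eq_of_mem _ _ _ hm]
  · rw [piecewise_eq_of_notMem _ _ _ hm, gammaKernel_eq_zero hm]

theorem recVar_castSucc {n : ℕ} (m : Fin (n + 1) → ℝ) (i : Fin n) :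
    recVar m i.castSucc = recVar (Fin.init m) i := by
  simp only [recVar, prevGap_eq, lowerMoment_eq, initial_castSucc]
  rfl

theorem recVar_last {n : ℕ} (m : Fin (n + 1) → ℝ) :
    recVar m (Fin.last n) = topGap m / topGap (Fin.init m) := by
  simp only [recVar, prevGap_eq, lowerMoment_eq, initial_last]
  rfl

/-- The product of the ratios telescopes. -/
theorem prod_recVar {n : ℕ} {m : Fin n → ℝ} (hm : m ∈ regularMoments n) :
    ∏ i, recVar m i = topGap m := by
  induction n with
  | zero => simp [topGap]
  | succ n ih =>
    have hm' := (mem_regularMoments_succ.1 hm).1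
    simp only [Fin.prod_univ_castSucc, recVar_castSucc, recVar_last, ih hm']
    exact mul_div_cancel₀ _ (topGap_pos hm').ne'

theorem gammaKernel_mul_topGap (γ δ : ℕ → ℝ) {n : ℕ} (m : Fin n → ℝ) :
    gammaKernel γ δ n m * topGap m = gammaKernel (fun k => γ k + 1) δ n m := by
  by_cases hm : m ∈ regularMoments n
  · rw [gammaKernel_of_mem _ _ hm, gammaKernel_of_mem _ _ hm, ← prod_recVar hm,
      ← Finset.prod_mul_distrib]
    refine Finset.prod_congr rfl fun i _ => ?_
    rw [Real.rpow_add_one (recVar_pos hm i).ne']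
    ring
  · rw [gammaKernel_eq_zero hm, gammaKernel_eq_zero hm, zero_mul]

theorem gammaKernel_snoc (γ δ : ℕ → ℝ) {n : ℕ} (m : Fin n → ℝ) (y : ℝ) :
    gammaKernel γ δ (n + 1) (Fin.snoc m y) = gammaKernel γ δ n m *
      (((y - infNext (Ici 0) m) / topGap m) ^ γ (n + 1) *
        Real.exp (-δ (n + 1) * ((y - infNext (Ici 0) m) / topGap m)) *
        (if infNext (Ici 0) m < y then 1 else 0)) := by
  simp only [gammaKernel, Fin.prod_univ_castSucc, lowerMoment_eq, prevGap_eq, initial_castSucc,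
    initial_last, Fin.init_snoc, Fin.snoc_castSucc, Fin.snoc_last, Fin.val_castSucc, Fin.val_last]

/-- The factor `P` is the Jacobian of `y ↦ (y - L) / P`; in the application it is `topGap` of the
earlier coordinates. -/
theorem lintegral_gamma {γ δ P : ℝ} (hγ : -1 < γ) (hδ : 0 < δ) (hP : 0 < P) (L : ℝ) :
    ∫⁻ y, ENNReal.ofReal (((y - L) / P) ^ γ * Real.exp (-δ * ((y - L) / P)) *
      (if L < y then 1 else 0)) =
    ENNReal.ofReal (P * (Real.Gamma (γ + 1) / δ ^ (γ + 1))) := by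
  have hshift := lintegral_sub_right_eq_self (μ := (volume : Measure ℝ))
    (fun t => ENNReal.ofReal ((t / P) ^ γ * Real.exp (-δ * (t / P)) *
      (if 0 < t then 1 else 0))) L
  simp only [sub_pos] at hshift
  rw [hshift]
  have hind : (fun t : ℝ => ENNReal.ofReal ((t / P) ^ γ * Real.exp (-δ * (t / P)) *
      (if 0 < t then 1 else 0))) = (Ioi 0).indicator fun t =>
        ENNReal.ofReal (P⁻¹ ^ γ * (t ^ γ * Real.exp (-(δ / P) * t))) := by
    ext t
    by_cases ht : 0 < t
    · rw [indicator_of_mem (show t ∈ Ioi 0 from ht), if_pos ht, mul_one, div_eq_mul_inv t,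
        Real.mul_rpow ht.le (inv_pos.2 hP).le]
      congr 1
      rw [show -δ * (t * P⁻¹) = -(δ / P) * t by ring]
      ring
    · rw [indicator_of_notMem (show t ∉ Ioi 0 from ht), if_neg ht, mul_zero, ENNReal.ofReal_zero]
  have hint := integrableOn_rpow_mul_exp hγ (div_pos hδ hP)
  rw [hind, lintegral_indicator measurableSet_Ioi, ← ofReal_integral_eq_lintegral_ofReal
    (hint.const_mul _), integral_const_mul, integral_rpow_mul_exp hγ (div_pos hδ hP)]
  · congr 1
    rw [Real.div_rpow hδ.le hP.le, Real.inv_rpow hP.le, Real.rpow_add_one hP.ne']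
    have := (Real.rpow_pos_of_pos hP γ).ne'
    have := (Real.rpow_pos_of_pos hδ (γ + 1)).ne'
    field_simp
  · refine (ae_restrict_iff' measurableSet_Ioi).2 (Eventually.of_forall fun t ht => ?_)
    have ht0 : (0 : ℝ) < t := ht
    simp only [Pi.zero_apply]
    positivity

theorem lintegral_fin_succ {n : ℕ} {f : (Fin (n + 1) → ℝ) → ENNReal} (hf : Measurable f) :
    ∫⁻ m, f m = ∫⁻ m' : Fin n → ℝ, ∫⁻ y : ℝ, f (Fin.snoc m' y) := by
  have hmp := (volume_preserving_piFinSuccAbove (fun _ : Fin (n + 1) => ℝ) (Fin.last n)).symm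
  rw [← hmp.lintegral_comp hf]
  rw [show (volume : Measure (ℝ × (Fin n → ℝ))) = volume.prod volume from rfl]
  refine (lintegral_prod_symm' _ (hf.comp (MeasurableEquiv.measurable _))).trans ?_
  refine lintegral_congr fun m' => lintegral_congr fun y => ?_
  rw [MeasurableEquiv.piFinSuccAbove_symm_apply]
  exact congrArg f (Fin.insertNth_last' y m')

theorem lintegral_gammaKernel {γ δ : ℕ → ℝ} (hγ : ∀ k : ℕ, 1 ≤ k → -1 < γ k)
    (hδ : ∀ k : ℕ, 1 ≤ k → 0 < δ k) (n : ℕ) :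
    ∫⁻ m, ENNReal.ofReal (gammaKernel γ δ n m) = ENNReal.ofReal (∏ i : Fin n,
      (Real.Gamma (γ (i + 1) + n - (i + 1 : ℕ) + 1) /
        δ (i + 1) ^ (γ (i + 1) + n - (i + 1 : ℕ) + 1))) := by
  induction n generalizing γ with
  | zero => simp [gammaKernel, volume_pi]
  | succ n ih =>
    have hinner : ∀ m : Fin n → ℝ,
        ∫⁻ y, ENNReal.ofReal (gammaKernel γ δ (n + 1) (Fin.snoc m y)) =
          ENNReal.ofReal (Real.Gamma (γ (n + 1) + 1) / δ (n + 1) ^ (γ (n + 1) + 1)) *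
            ENNReal.ofReal (gammaKernel (fun k => γ k + 1) δ n m) := fun m => by
      simp only [gammaKernel_snoc, ENNReal.ofReal_mul (gammaKernel_nonneg γ δ m)]
      rw [lintegral_const_mul' _ _ ENNReal.ofReal_ne_top]
      by_cases hm : m ∈ regularMoments n
      · rw [lintegral_gamma (hγ _ (by omega)) (hδ _ (by omega)) (topGap_pos hm),
          ← ENNReal.ofReal_mul (gammaKernel_nonneg γ δ m), ← mul_assoc,
          gammaKernel_mul_topGap, mul_comm, ENNReal.ofReal_mul' (gammaKernel_nonneg _ δ m)]
      · simp [gammaKernel_eq_zero hm]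
    rw [lintegral_fin_succ (measurable_gammaKernel γ δ (n + 1)).ennreal_ofReal]
    simp only [hinner]
    rw [lintegral_const_mul' _ _ ENNReal.ofReal_ne_top,
      ih fun k hk => by linarith [hγ k hk], ← ENNReal.ofReal_mul, mul_comm,
      Fin.prod_univ_castSucc]
    · congr 2
      · refine Finset.prod_congr rfl fun i _ => ?_
        rw [Fin.val_castSucc, show γ (i + 1) + ((n + 1 : ℕ) : ℝ) - (i + 1 : ℕ) + 1 =
          γ (i + 1) + 1 + n - (i + 1 : ℕ) + 1 by push_cast; ring]
      · rw [Fin.val_last, add_sub_cancel_right]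
    · have h1 := hγ (n + 1) (by omega)
      have h2 := hδ (n + 1) (by omega)
      have := Real.Gamma_pos_of_pos (show 0 < γ (n + 1) + 1 by linarith)
      positivity

theorem Gamma_arg_pos {γ : ℕ → ℝ} (hγ : ∀ k : ℕ, 1 ≤ k → -1 < γ k) {n : ℕ} (i : Fin n) :
    0 < γ (i + 1) + n - (i + 1 : ℕ) + 1 := by
  have h1 := hγ (i + 1) (by omega)
  have h2 : ((i + 1 : ℕ) : ℝ) ≤ n := by exact_mod_cast i.2
  linarith

theorem gammaConst_nonneg {γ δ : ℕ → ℝ} (hγ : ∀ k : ℕ, 1 ≤ k → -1 < γ k)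
    (hδ : ∀ k : ℕ, 1 ≤ k → 0 < δ k) (n : ℕ) : 0 ≤ gammaConst γ δ n := by
  rw [gammaConst, prod_Icc_one_eq_prod_fin]
  exact Finset.prod_nonneg fun i _ => div_nonneg (Real.rpow_nonneg (hδ _ (by omega)).le _)
    (Real.Gamma_pos_of_pos (Gamma_arg_pos hγ i)).le

theorem isDensityOn_gammaDensity {γ δ : ℕ → ℝ} (hγ : ∀ k : ℕ, 1 ≤ k → -1 < γ k)
    (hδ : ∀ k : ℕ, 1 ≤ k → 0 < δ k) (n : ℕ) :
    IsDensityOn (gammaDensity γ δ n) (momentSpace (Ici 0) n) := by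
  have hc := gammaConst_nonneg hγ hδ n
  refine ⟨(measurable_gammaKernel γ δ n).const_mul _,
    fun m => mul_nonneg hc (gammaKernel_nonneg γ δ m), ?_⟩
  have htot : ∫⁻ m, ENNReal.ofReal (gammaDensity γ δ n m) = 1 := by
    simp only [gammaDensity_eq_const_mul, ENNReal.ofReal_mul hc]
    rw [lintegral_const_mul' _ _ ENNReal.ofReal_ne_top, lintegral_gammaKernel hγ hδ,
      ← ENNReal.ofReal_mul hc, gammaConst, prod_Icc_one_eq_prod_fin, ← Finset.prod_mul_distrib,
      Finset.prod_eq_one, ENNReal.ofReal_one]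
    intro i _
    have h1 := (Real.Gamma_pos_of_pos (Gamma_arg_pos hγ i)).ne'
    have h2 := (Real.rpow_pos_of_pos (hδ (i + 1) (by omega))
      (γ (i + 1) + n - (i + 1 : ℕ) + 1)).ne'
    rw [div_mul_div_comm, mul_comm, div_self (mul_ne_zero h1 h2)]
  -- The mass over all of `ℝⁿ` is carried by `regularMoments`, which lies in the moment space, so
  -- restricting the integral loses nothing.
  refine le_antisymm (htot ▸ setLIntegral_le_lintegral _ _) ?_
  have hind : (fun m => ENNReal.ofReal (gammaDensity γ δ n m)) =
      (regularMoments n).indicator fun m => ENNReal.ofReal (gammaDensity γ δ n m) := by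
    ext m
    by_cases hm : m ∈ regularMoments n
    · rw [indicator_of_mem hm]
    · rw [indicator_of_notMem hm, gammaDensity_eq_zero hm, ENNReal.ofReal_zero]
  rw [← htot, hind, lintegral_indicator (isOpen_regularMoments n).measurableSet, ← hind]
  exact lintegral_mono_set ((regularMoments_subset_interior n).trans interior_subset)

end MomentSpace

theorem mainTheorem6 (n : ℕ) (γd δd : ℝ → ℕ → ℝ) (γ δ : ℕ → ℝ)
    (hγ : ∀ k : ℕ, 1 ≤ k → -1 < γ k)
    (hδ : ∀ k : ℕ, 1 ≤ k → 0 < δ k)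
    (hγd : ∀ k : ℕ, 1 ≤ k → Tendsto (fun d : ℝ => γd d k) atTop (𝓝 (γ k)))
    (hδd : ∀ k : ℕ, 1 ≤ k → Tendsto (fun d : ℝ => δd d k / d) atTop (𝓝 (δ k))) :
    (∀ m ∈ MomentSpace.momentSpace (Ici 0) n,
      Tendsto (fun d : ℝ => MomentSpace.betaDensity 0 d (γd d) (δd d) n m) atTop
        (𝓝 (MomentSpace.gammaDensity γ δ n m))) ∧
    (∀ m ∈ MomentSpace.momentSpace (Ici 0) n,
      MomentSpace.gammaDensity γ δ n m =
        MomentSpace.gammaConst γ δ n * ∏ i : Fin n,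
          (MomentSpace.recVar m i ^ γ (i + 1) *
            Real.exp (-δ (i + 1) * MomentSpace.recVar m i) *
            (if 0 < MomentSpace.recVar m i then 1 else 0))) ∧
    MomentSpace.IsDensityOn (MomentSpace.gammaDensity γ δ n)
      (MomentSpace.momentSpace (Ici 0) n) :=
  ⟨fun m _ => MomentSpace.tendsto_betaDensity hγ hδ hγd hδd m,
    fun _ hm => MomentSpace.gammaDensity_eq_recVar γ δ hm,
    MomentSpace.isDensityOn_gammaDensity hγ hδ n⟩
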